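/- Setting. Let $K,N,B,t$ be integers with $0\le t<K$ and let $\mu=t/K$. A transmitter has $N$ independent, uniformly distributed files of $F$ bits each. A caching strategy $\mathfrak C$ gives every user $k\in[K]$ a finite union $\mathbf c_k\subseteq(0,1]$ of successive intervals $(a,b]$ of total length $\mu$, and user $k$ caches from every file the bits with numbers $\lceil aF\rceil+1,\dots,\lfloor bF\rfloor$ for each of its intervals. Assume that $\mathfrak C$ is centralized: for every $\mathcal T\subseteq[K]$ with $|\mathcal T|=t$, the set of points of $(0,1]$ that lie in $\mathbf c_k$ exactly for $k\in\mathcal T$ has measure $1/\binom Kt$ (the central caching strategy is of this kind). User $k$ requests file $d_k$, where $d_1,\dots,d_K$ are distinct. In each of $n$ channel uses the transmitter sends $X_s\in\mathbb F_2^B$, a function of all the files, and user $k$ receives the first $L_k[s]$ bits of $X_s$. The states $L_k[1],\dots,L_k[n]\in\{0,\dots,B\}$ are i.i.d. with an arbitrary given law $P_{L_k}$, are independent of the files, and are known to user $k$ but not to the transmitter; put $\overline F_{L_k}(\ell)=\mathbb P[L_k\ge\ell]$. User $k$ estimates file $d_k$ from its channel states, its channel outputs and its cache, and $P_e^{(n)}$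 is the sum over $k$ of the probabilities of a wrong estimate. Files of $F_n$ bits are reliably served if there are encoders and decoders for all $n$ with $P_e^{(n)}\to0$. A source rate $f\ge 0$ is achievable if files of some lengths $F_n$ with $F_n/n\to f$ are reliably served. Claim. The linear program that maximizes $f$ over all $f\ge0$ and $y_{\ell,\mathcal S}\ge0$ ($\ell\in[B]$, $\mathcal S\subseteq[K]$, $|\mathcal S|=t+1$) subject to $$\sum_{\mathcal S}y_{\ell,\mathcal S}\le1\quad(\ell\in[B]),\qquad \sum_{\ell=1}^B\overline F_{L_k}(\ell)\,y_{\ell,\mathcal S}\ge\frac f{\binom Kt}\quad(|\mathcal S|=t+1,\ k\in\mathcal S)$$ has an optimal value $f_{\mathsf{LP}}$, and the source rate $f_{\mathsf{LP}}$ is achievable. Moreover, for every $f$ with $0\le f<f_{\mathsf{LP}}$, files of exactly $F_n=\lfloor nf\rfloor$ bits are reliably served. -/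

import Mathlib

open Filter Topology MeasureTheory

namespace CodedCaching

noncomputable section

/-- A caching strategy for `K` users with normalized cache size `μ`: user `k` has the finitely many
intervals `(left k j, right k j] ⊆ (0, 1]`, listed from left to right without overlap
(an interval may be empty), of total length `μ`. -/
structure CachingStrategy (K : ℕ) (μ : ℝ) where
  num : Fin K → ℕ
  num_pos : ∀ k, 0 < num k
  left : (k : Fin K) → Fin (num k) → ℝ
  right : (k : Fin K) → Fin (num k) → ℝ
  left_nonneg : ∀ k j, 0 ≤ left k j
  left_le_right : ∀ k j, left k j ≤ right k j
  right_le_one : ∀ k j, right k j ≤ 1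
  ordered : ∀ k (i j : Fin (num k)), i < j → right k i ≤ left k j
  total_length : ∀ k, ∑ j, (right k j - left k j) = μ

namespace CachingStrategy

variable {K : ℕ} {μ : ℝ}

/-- The part `c_k` of the unit interval that user `k` caches. -/
def region (C : CachingStrategy K μ) (k : Fin K) : Set ℝ :=
  ⋃ j, Set.Ioc (C.left k j) (C.right k j)

/-- The part of the unit interval that is cached by the users in `T` and by nobody else. -/
def exactRegion (C : CachingStrategy K μ) (T : Finset (Fin K)) : Set ℝ :=
  {x | x ∈ Set.Ioc (0 : ℝ) 1 ∧ ∀ k, x ∈ C.region k ↔ k ∈ T}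

/-- Every set of exactly `t` users exclusively shares the same fraction `1 / (K choose t)`
of each file. -/
def IsCentralized (C : CachingStrategy K μ) (t : ℕ) : Prop :=
  ∀ T : Finset (Fin K), T.card = t → volume.real (C.exactRegion T) = 1 / (K.choose t : ℝ)

/-- The positions of the bits of a file of `F` bits that user `k` caches: the bits with numbers
`⌈a F⌉ + 1, …, ⌊b F⌋` for the intervals `(a, b]` of the user. The element `i : Fin F` stands for
the bit with number `i + 1`. -/
def cachedBits (C : CachingStrategy K μ) (F : ℕ) (k : Fin K) : Set (Fin F) :=
  {i | ∃ j, ⌈C.left k j * F⌉ + 1 ≤ (i : ℤ) + 1 ∧ (i : ℤ) + 1 ≤ ⌊C.right k j * F⌋}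

end CachingStrategy

/-- A library of `N` files of `F` bits each. -/
abbrev Library (N F : ℕ) : Type := Fin N → Fin F → ZMod 2

/-- The complementary distribution function of the channel state of one user at the level
with number `ℓ + 1`: the probability that at least `ℓ + 1` bits are delivered. -/
def ccdf {B : ℕ} (p : PMF (Fin (B + 1))) (ℓ : Fin B) : ℝ :=
  p.toMeasure.real {m | (ℓ : ℕ) + 1 ≤ (m : ℕ)}

/-- The output of the channel: of the `B` bits sent, the first `L` ones are delivered, and the
others are blanked out. -/
def received {B : ℕ} (L : Fin (B + 1)) (x : Fin B → ZMod 2) : Fin B → ZMod 2 :=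
  fun ℓ => if (ℓ : ℕ) + 1 ≤ (L : ℕ) then x ℓ else 0

/-- The cache of user `k`: its bits of all the files. -/
def cacheContent {K : ℕ} {μ : ℝ} (C : CachingStrategy K μ) {N F : ℕ} (k : Fin K)
    (W : Library N F) : Fin N → C.cachedBits F k → ZMod 2 :=
  fun i j => W i j

/-- An encoder and `K` decoders for block length `n` and files of `F` bits. The encoder sees the
library (which determines all the caches), but not the channel states. The decoder of user `k` sees
the channel states of that user, the channel outputs and the cache of that user. -/
structure Code {K : ℕ} {μ : ℝ} (C : CachingStrategy K μ) (N B n F : ℕ) where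
  encode : Library N F → Fin n → Fin B → ZMod 2
  decode : (k : Fin K) → (Fin n → Fin (B + 1)) → (Fin n → Fin B → ZMod 2) →
    (Fin N → C.cachedBits F k → ZMod 2) → Fin F → ZMod 2

/-- The estimate of user `k` when the library is `W` and its channel states are `L`. -/
def Code.estimate {K : ℕ} {μ : ℝ} {C : CachingStrategy K μ} {N B n F : ℕ} (c : Code C N B n F)
    (k : Fin K) (W : Library N F) (L : Fin n → Fin (B + 1)) : Fin F → ZMod 2 :=
  c.decode k L (fun s => received (L s) (c.encode W s)) (cacheContent C k W)

/-- The sum over the users of the probabilities of decoding the requested file wrongly. The library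
is uniformly distributed and independent of the channel states; the states of user `k` are
independent over time with law `P k`. How the states of different users depend on each other does
not affect this sum. -/
def Code.errorProb {K : ℕ} {μ : ℝ} {C : CachingStrategy K μ} {N B n F : ℕ} (c : Code C N B n F)
    (P : Fin K → PMF (Fin (B + 1))) (d : Fin K → Fin N) : ℝ :=
  ∑ k, (∑ W : Library N F,
    (Measure.pi fun _ : Fin n => (P k).toMeasure).real {L | c.estimate k W L ≠ W (d k)}) /
      Fintype.card (Library N F)

/-- With files of `F n` bits at block length `n`, the requests `d` can be served with an error
probability that tends to `0`. -/
def ReliablyServed {K : ℕ} {μ : ℝ} (C : CachingStrategy K μ) {N B : ℕ}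
    (P : Fin K → PMF (Fin (B + 1))) (d : Fin K → Fin N) (F : ℕ → ℕ) : Prop :=
  ∃ c : (n : ℕ) → Code C N B n (F n), Tendsto (fun n => (c n).errorProb P d) atTop (𝓝 0)

/-- The source rate `f` (in bits per file and channel use) is achievable: files of `n f + o(n)` bits
can be served with an error probability that tends to `0`. -/
def IsAchievable {K : ℕ} {μ : ℝ} (C : CachingStrategy K μ) {N B : ℕ}
    (P : Fin K → PMF (Fin (B + 1))) (d : Fin K → Fin N) (f : ℝ) : Prop :=
  ∃ F : ℕ → ℕ, Tendsto (fun n => (F n : ℝ) / n) atTop (𝓝 f) ∧ ReliablyServed C P d F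

/-- Feasibility of the rate `f` and the allocation `y` of time fractions of the levels to the
coded messages, which are indexed by the sets of `t + 1` users. -/
structure LPFeasible {K B : ℕ} (P : Fin K → PMF (Fin (B + 1))) (t : ℕ) (f : ℝ)
    (y : Fin B → {S : Finset (Fin K) // S.card = t + 1} → ℝ) : Prop where
  rate_nonneg : 0 ≤ f
  nonneg : ∀ ℓ S, 0 ≤ y ℓ S
  level : ∀ ℓ, ∑ S, y ℓ S ≤ 1
  decodable : ∀ S, ∀ k ∈ S.1, f / (K.choose t : ℝ) ≤ ∑ ℓ, ccdf (P k) ℓ * y ℓ S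

/-- The rates that are feasible for the linear program. -/
def lpRates {K B : ℕ} (P : Fin K → PMF (Fin (B + 1))) (t : ℕ) : Set ℝ :=
  {f | ∃ y, LPFeasible P t f y}

/-- The optimal value of the linear program. -/
def fLP {K B : ℕ} (P : Fin K → PMF (Fin (B + 1))) (t : ℕ) : ℝ :=
  sSup (lpRates P t)

end

end CodedCaching

/-! Up to a bounded number of bits, a file splits into pieces of at most `F / K.choose t + O(1)`
bits, one for each set of `t` users that cache it (`IsCentralized.card_cachers_eq_le`,
`IsCentralized.card_cachers_ne_le`). For a set `S` of `t + 1` users, add up, over `k ∈ S`, the piece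
that `k` wants and exactly the rest of `S` holds. Each member of `S` can cancel the summands of the
others, so this one message serves all of `S` (`exists_codedMessages`).

It remains to deliver these messages. For user `k`, level `ℓ` is an erasure channel whose input
survives with probability `ccdf (P k) ℓ`. Give `S` a fraction `y ℓ S` of the uses of level `ℓ` and
fill them with bits of a random codeword. By Chebyshev about `n * ∑ ℓ, ccdf (P k) ℓ * y ℓ S` of them
arrive (`measureReal_delivered_lt_le`). By the union bound, `h` delivered bits beyond the message
length leave at most a fraction `2 ^ (-h)` of the codebooks ambiguous (`natCard_ambiguous_le`), and
averaging yields one codebook for all users (`exists_code`).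

The constraints of the program say that enough bits arrive on average. Below the optimum there is
slack linear in `n`, which pays for fluctuations, rounding and exceptional bits
(`reliablyServed_of_lt`). The optimum is attained by compactness (`isGreatest_fLP`), and its rate is
reached by letting smaller rates tend to it slowly (`isAchievable_of_forall_lt`). -/

namespace CodedCaching

/-! ### Counting the bits cached by a given set of users -/

namespace CachingStrategy

variable {K : ℕ} {μ : ℝ}

lemma measurableSet_region (C : CachingStrategy K μ) (k : Fin K) : MeasurableSet (C.region k) :=
  MeasurableSet.iUnion fun _ => measurableSet_Ioc

lemma measurableSet_exactRegion (C : CachingStrategy K μ) (T : Finset (Fin K)) :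
    MeasurableSet (C.exactRegion T) := by
  have h : C.exactRegion T =
      Set.Ioc (0 : ℝ) 1 ∩ ⋂ k, {x | x ∈ C.region k ↔ k ∈ T} := by
    ext x; simp [exactRegion]
  rw [h]
  refine measurableSet_Ioc.inter (MeasurableSet.iInter fun k => ?_)
  by_cases hk : k ∈ T
  · simpa [hk] using C.measurableSet_region k
  · have : {x | x ∈ C.region k ↔ k ∈ T} = (C.region k)ᶜ := by ext x; simp [hk]
    rw [this]
    exact (C.measurableSet_region k).compl

lemma exactRegion_subset (C : CachingStrategy K μ) (T : Finset (Fin K)) :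
    C.exactRegion T ⊆ Set.Ioc (0 : ℝ) 1 := fun _ hx => hx.1

lemma disjoint_exactRegion (C : CachingStrategy K μ) {T T' : Finset (Fin K)} (h : T ≠ T') :
    Disjoint (C.exactRegion T) (C.exactRegion T') := by
  rw [Set.disjoint_left]
  intro x hx hx'
  exact h (Finset.ext fun k => (hx.2 k).symm.trans (hx'.2 k))

lemma volume_exactRegion_ne_top (C : CachingStrategy K μ) (T : Finset (Fin K)) :
    volume (C.exactRegion T) ≠ ⊤ :=
  measure_ne_top_of_subset (C.exactRegion_subset T) (by simp)

/-- Under centralized caching almost every point is cached by exactly `t` users. -/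
lemma IsCentralized.volume_exactRegion_eq_zero {C : CachingStrategy K μ} {t : ℕ}
    (hC : C.IsCentralized t) (htK : t < K) {T : Finset (Fin K)} (hT : T.card ≠ t) :
    volume.real (C.exactRegion T) = 0 := by
  classical
  -- The disjoint regions of the `t`-sets already fill measure 1 of the unit interval, so adding `T`
  -- leaves nothing for it.
  set 𝒯 : Finset (Finset (Fin K)) := insert T (Finset.univ.powersetCard t) with h𝒯
  have hnot : T ∉ (Finset.univ : Finset (Fin K)).powersetCard t := by
    simp [Finset.mem_powersetCard, hT]
  have hunion : volume.real (⋃ T' ∈ 𝒯, C.exactRegion T') ≤ 1 := by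
    have : volume.real (Set.Ioc (0 : ℝ) 1) = 1 := by simp
    rw [← this]
    exact measureReal_mono (Set.iUnion₂_subset fun T' _ => C.exactRegion_subset T') (by simp)
  rw [measureReal_biUnion_finset (fun _ _ _ _ h => C.disjoint_exactRegion h)
    (fun T' _ => C.measurableSet_exactRegion T')
    (fun T' _ => C.volume_exactRegion_ne_top T'), h𝒯, Finset.sum_insert hnot] at hunion
  have hsum : ∑ T' ∈ (Finset.univ : Finset (Fin K)).powersetCard t,
      volume.real (C.exactRegion T') = 1 := by
    rw [Finset.sum_congr rfl fun T' hT' => hC T' (Finset.mem_powersetCard.1 hT').2]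
    have : (K.choose t : ℝ) ≠ 0 := by exact_mod_cast (Nat.choose_pos htK.le).ne'
    simp [Finset.card_powersetCard, this]
  have := measureReal_nonneg (μ := volume) (s := C.exactRegion T)
  linarith

open Classical in
/-- The users that cache the bit at position `i`. -/
noncomputable def cachers (C : CachingStrategy K μ) {F : ℕ} (i : Fin F) : Finset (Fin K) :=
  Finset.univ.filter fun k => i ∈ C.cachedBits F k

lemma mem_cachers {C : CachingStrategy K μ} {F : ℕ} {i : Fin F} {k : Fin K} :
    k ∈ C.cachers i ↔ i ∈ C.cachedBits F k := by
  classical simp [cachers]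

open Classical in
/-- The end points of all the intervals. -/
noncomputable def endpoints (C : CachingStrategy K μ) : Finset ℝ :=
  Finset.univ.biUnion fun k => Finset.univ.image (C.left k) ∪ Finset.univ.image (C.right k)

lemma left_mem_endpoints (C : CachingStrategy K μ) (k : Fin K) (j) :
    C.left k j ∈ C.endpoints := by
  classical
  simp only [endpoints, Finset.mem_biUnion, Finset.mem_union, Finset.mem_image]
  exact ⟨k, Finset.mem_univ _, Or.inl ⟨j, Finset.mem_univ _, rfl⟩⟩

lemma right_mem_endpoints (C : CachingStrategy K μ) (k : Fin K) (j) :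
    C.right k j ∈ C.endpoints := by
  classical
  simp only [endpoints, Finset.mem_biUnion, Finset.mem_union, Finset.mem_image]
  exact ⟨k, Finset.mem_univ _, Or.inr ⟨j, Finset.mem_univ _, rfl⟩⟩

/-- The open part of the unit interval that corresponds to the bit at position `i`. -/
def cell {F : ℕ} (i : Fin F) : Set ℝ :=
  {x | (i : ℝ) < x * F ∧ x * F < (i : ℝ) + 1}

lemma cell_eq_Ioo {F : ℕ} (i : Fin F) : cell i = Set.Ioo ((i : ℝ) / F) (((i : ℝ) + 1) / F) := by
  have hF : (0 : ℝ) < F := by exact_mod_cast i.pos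
  ext x
  simp [cell, div_lt_iff₀ hF, lt_div_iff₀ hF]

lemma volume_cell {F : ℕ} (i : Fin F) : volume.real (cell i) = 1 / F := by
  have hF : (0 : ℝ) < F := by exact_mod_cast i.pos
  rw [cell_eq_Ioo, Real.volume_real_Ioo_of_le (by gcongr; linarith)]
  ring

lemma eq_of_mem_cell {F : ℕ} {i i' : Fin F} {x : ℝ} (h : x ∈ cell i) (h' : x ∈ cell i') :
    i = i' := by
  have h1 : ((i : ℕ) : ℝ) < (i' : ℕ) + 1 := h.1.trans h'.2
  have h2 : ((i' : ℕ) : ℝ) < (i : ℕ) + 1 := h'.1.trans h.2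
  ext
  norm_cast at h1 h2
  omega

/-- The positions whose cell contains an end point of some interval. -/
def IsBoundary (C : CachingStrategy K μ) {F : ℕ} (i : Fin F) : Prop :=
  ∃ e ∈ C.endpoints, e ∈ cell i

-- Cells are disjoint, so boundary positions own distinct end points. The bound does not depend on
-- `F`.
open Classical in
lemma card_isBoundary_le (C : CachingStrategy K μ) (F : ℕ) :
    (Finset.univ.filter fun i : Fin F => C.IsBoundary i).card ≤ C.endpoints.card := by
  choose! e he hcell using fun (i : Fin F) (h : C.IsBoundary i) => h
  refine Finset.card_le_card_of_injOn e (fun i hi => ?_) (fun i hi i' hi' h => ?_)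
  · exact he i (by simpa using hi)
  · have h1 := hcell i (by simpa using hi)
    have h2 := hcell i' (by simpa using hi')
    rw [h] at h1
    exact eq_of_mem_cell h1 h2

/-- By the rounding in `cachedBits`, an interval `(a, b]` provides bit `i` exactly if `a F ≤ i` and
`i + 1 ≤ b F`, that is, if the whole cell fits into it. A cell without end points lies inside or
outside each interval entirely. -/
lemma cell_subset_exactRegion {C : CachingStrategy K μ} {F : ℕ} {i : Fin F}
    (hi : ¬ C.IsBoundary i) : cell i ⊆ C.exactRegion (C.cachers i) := by
  have hF : (0 : ℝ) < F := by exact_mod_cast i.pos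
  have hiF : (i : ℝ) + 1 ≤ F := by exact_mod_cast i.isLt
  have hi0 : (0 : ℝ) ≤ (i : ℕ) := Nat.cast_nonneg _
  rintro x ⟨h1, h2⟩
  refine ⟨⟨?_, ?_⟩, fun k => ?_⟩
  · by_contra! h
    nlinarith
  · by_contra! h
    nlinarith
  rw [mem_cachers]
  simp only [region, Set.mem_iUnion, Set.mem_Ioc, cachedBits, Set.mem_ofPred_eq,
    add_le_add_iff_right, Int.ceil_le, Int.le_floor]
  push_cast
  refine exists_congr fun j => ?_
  have hl : ¬ ((i : ℝ) < C.left k j * F ∧ C.left k j * F < (i : ℝ) + 1) :=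
    fun h => hi ⟨_, C.left_mem_endpoints k j, h⟩
  have hr : ¬ ((i : ℝ) < C.right k j * F ∧ C.right k j * F < (i : ℝ) + 1) :=
    fun h => hi ⟨_, C.right_mem_endpoints k j, h⟩
  constructor
  · rintro ⟨ha, hb⟩
    refine ⟨?_, ?_⟩
    · by_contra! h
      exact hl ⟨h, (mul_lt_mul_of_pos_right ha hF).trans h2⟩
    · by_contra! h
      exact hr ⟨h1.trans_le (mul_le_mul_of_nonneg_right hb hF.le), h⟩
  · rintro ⟨ha, hb⟩
    exact ⟨lt_of_mul_lt_mul_right (ha.trans_lt h1) hF.le,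
      (lt_of_mul_lt_mul_right (h2.trans_le hb) hF.le).le⟩

open Classical in
/-- Apart from the positions that meet an end point, the bits are shared among the sets of users
in proportion to the measures of the regions. -/
lemma card_filter_cachers_le (C : CachingStrategy K μ) (F : ℕ) (T : Finset (Fin K)) :
    ((Finset.univ.filter fun i : Fin F => C.cachers i = T ∧ ¬ C.IsBoundary i).card : ℝ) ≤
      F * volume.real (C.exactRegion T) := by
  rcases Nat.eq_zero_or_pos F with rfl | hF
  · simp
  have hF' : (0 : ℝ) < F := by exact_mod_cast hF
  set A := Finset.univ.filter fun i : Fin F => C.cachers i = T ∧ ¬ C.IsBoundary i with hA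
  -- Disjoint cells of length `1 / F` are packed into the region.
  have hmeas : volume.real (⋃ i ∈ A, cell i) ≤ volume.real (C.exactRegion T) := by
    refine measureReal_mono (Set.iUnion₂_subset fun i hi => ?_) (C.volume_exactRegion_ne_top T)
    simp only [hA, Finset.mem_filter] at hi
    rw [← hi.2.1]
    exact cell_subset_exactRegion hi.2.2
  rw [measureReal_biUnion_finset (fun i _ i' _ h => Set.disjoint_left.2 fun x hx hx' =>
      h (eq_of_mem_cell hx hx')) (fun i _ => by rw [cell_eq_Ioo]; exact measurableSet_Ioo)
      (fun i _ => by rw [cell_eq_Ioo]; simp), Finset.sum_congr rfl fun i _ => volume_cell i] at hmeas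
  simp only [Finset.sum_const, nsmul_eq_mul, mul_one_div] at hmeas
  rwa [div_le_iff₀ hF', mul_comm] at hmeas

open Classical in
lemma IsCentralized.card_cachers_eq_le {C : CachingStrategy K μ} {t : ℕ}
    (hC : C.IsCentralized t) (F : ℕ) {T : Finset (Fin K)} (hT : T.card = t) :
    ((Finset.univ.filter fun i : Fin F => C.cachers i = T).card : ℝ) ≤
      F / (K.choose t : ℝ) + C.endpoints.card := by
  have h1 := C.card_filter_cachers_le F T
  have h2 : ((Finset.univ.filter fun i : Fin F => C.IsBoundary i).card : ℝ) ≤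
    C.endpoints.card := by exact_mod_cast C.card_isBoundary_le F
  rw [hC T hT, mul_one_div] at h1
  have h3 : (Finset.univ.filter fun i : Fin F => C.cachers i = T) ⊆
      (Finset.univ.filter fun i : Fin F => C.cachers i = T ∧ ¬ C.IsBoundary i) ∪
      (Finset.univ.filter fun i : Fin F => C.IsBoundary i) := by
    intro i
    simp only [Finset.mem_union, Finset.mem_filter, Finset.mem_univ, true_and]
    tauto
  have h4 := (Finset.card_le_card h3).trans (Finset.card_union_le _ _)
  have h5 : ((Finset.univ.filter fun i : Fin F => C.cachers i = T).card : ℝ) ≤ _ :=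
    Nat.cast_le.2 h4
  push_cast at h5
  linarith

-- Any other such position would place a cell of length `1 / F` inside a null region.
open Classical in
lemma IsCentralized.card_cachers_ne_le {C : CachingStrategy K μ} {t : ℕ}
    (hC : C.IsCentralized t) (htK : t < K) (F : ℕ) :
    (Finset.univ.filter fun i : Fin F => (C.cachers i).card ≠ t).card ≤ C.endpoints.card := by
  refine (Finset.card_le_card fun i hi => ?_).trans (C.card_isBoundary_le F)
  simp only [Finset.mem_filter, Finset.mem_univ, true_and] at hi ⊢
  by_contra hb
  have hF : (0 : ℝ) < F := by exact_mod_cast i.pos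
  have h1 := measureReal_mono (μ := volume) (cell_subset_exactRegion hb)
    (C.volume_exactRegion_ne_top _)
  rw [hC.volume_exactRegion_eq_zero htK hi, volume_cell] at h1
  exact absurd h1 (not_le.2 (by positivity))

end CachingStrategy

/-! ### Coded multicast messages -/

/-- The coded messages for the sets of `t + 1` users: the sums of the pieces that one user wants and
the other ones have, together with the exceptional bits that are not shared by `t` users. -/
lemma exists_codedMessages {K N t F g : ℕ} {μ : ℝ} (C : CachingStrategy K μ) (d : Fin K → Fin N)
    (hg : ∀ T : Finset (Fin K), T.card = t →
      Nat.card {i : Fin F // C.cachers i = T} ≤ g) :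
    ∃ M : {S : Finset (Fin K) // S.card = t + 1} → Library N F →
        (Fin g → ZMod 2) × (Fin K × {i : Fin F // (C.cachers i).card ≠ t} → ZMod 2),
      ∀ k W W', cacheContent C k W = cacheContent C k W' →
        (∀ S : {S : Finset (Fin K) // S.card = t + 1}, k ∈ S.1 → M S W = M S W') →
        (∃ S : {S : Finset (Fin K) // S.card = t + 1}, k ∈ S.1) →
        W (d k) = W' (d k) := by
  classical
  have hemb : ∀ T : Finset (Fin K), ∃ pos : Fin F → ℕ, T.card = t →
      (∀ i, C.cachers i = T → pos i < g) ∧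
      (∀ i i', C.cachers i = T → C.cachers i' = T → pos i = pos i' → i = i') := by
    intro T
    by_cases hT : T.card = t
    · have hle : Fintype.card {i : Fin F // C.cachers i = T} ≤ Fintype.card (Fin g) := by
        rw [← Nat.card_eq_fintype_card, Fintype.card_fin]
        exact hg T hT
      obtain ⟨e⟩ := Function.Embedding.nonempty_of_card_le hle
      refine ⟨fun i => if h : C.cachers i = T then e ⟨i, h⟩ else 0, fun _ => ⟨?_, ?_⟩⟩
      · intro i hi
        simp [hi]
      · intro i i' hi hi' h
        simp only [hi, hi', dif_pos] at h
        simpa using e.injective (Fin.ext h)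
    · exact ⟨0, fun h => absurd h hT⟩
  choose pos hpos using hemb
  -- The inner sum has at most one term, and an empty one pads a short piece with 0. The exceptional
  -- bits are sent uncoded in every message.
  refine ⟨fun S W => (fun p => ∑ j ∈ S.1, ∑ i with
      (C.cachers i = S.1.erase j ∧ pos (S.1.erase j) i = p), W (d j) i, fun q => W (d q.1) q.2),
    fun k W W' hcache hM hS => funext fun i => ?_⟩
  have hknown : ∀ (a : Fin N) (b : Fin F), k ∈ C.cachers b → W a b = W' a b := fun a b hb =>
    congrFun (congrFun hcache a) ⟨b, CachingStrategy.mem_cachers.1 hb⟩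
  by_cases hk : k ∈ C.cachers i
  · exact hknown _ _ hk
  by_cases hi : (C.cachers i).card = t
  · have hcard : (insert k (C.cachers i)).card = t + 1 := by
      rw [Finset.card_insert_of_notMem hk, hi]
    have hlt := (hpos _ hi).1 i rfl
    have h := congrFun (congrArg Prod.fst (hM ⟨_, hcard⟩ (Finset.mem_insert_self _ _)))
      ⟨pos (C.cachers i) i, hlt⟩
    simp only [Finset.sum_insert hk, Finset.erase_insert hk] at h
    have hrest : ∀ V : Library N F, ∑ i' with (C.cachers i' = C.cachers i ∧
        pos (C.cachers i) i' = pos (C.cachers i) i), V (d k) i' = V (d k) i := by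
      intro V
      rw [Finset.sum_eq_single i]
      · intro b hb hne
        simp only [Finset.mem_filter, Finset.mem_univ, true_and] at hb
        exact absurd ((hpos _ hi).2 b i hb.1 rfl hb.2) hne
      · simp
    rw [hrest, hrest] at h
    refine add_right_cancel (h.trans (congrArg _ (Finset.sum_congr rfl fun j hj => ?_)))
    refine Finset.sum_congr rfl fun b hb => (hknown _ _ ?_).symm
    simp only [Finset.mem_filter, Finset.mem_univ, true_and] at hb
    rw [hb.1]
    exact Finset.mem_erase.2 ⟨fun h => hk (h ▸ hj), Finset.mem_insert_self _ _⟩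
  · obtain ⟨S, hkS⟩ := hS
    exact congrFun (congrArg Prod.snd (hM S hkS)) (k, ⟨i, hi⟩)

/-! ### Random codebooks -/

/-- Among all the codebooks, the fraction of those in which two given codewords agree on `R`
is at most `2 ^ (-|R|)`. -/
lemma card_collision_le {A ι : Type*} [Fintype A] [DecidableEq A] [Fintype ι] [DecidableEq ι]
    {v w : A} (hvw : w ≠ v) (R : Finset ι) :
    (Finset.univ.filter fun E : A → ι → ZMod 2 => ∀ i ∈ R, E w i = E v i).card * 2 ^ R.card ≤
      Fintype.card (A → ι → ZMod 2) := by
  have hR : 2 ^ R.card = (Finset.univ : Finset (R → ZMod 2)).card := by simp [ZMod.card]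
  rw [hR, ← Finset.card_product, ← Finset.card_univ]
  -- Shift row `w` of a colliding codebook by `u` on `R`. Row `v` is unchanged and equals the old
  -- row `w` on `R`, so the shift can be read off and undone.
  refine Finset.card_le_card_of_injOn
    (fun q a i => if h : a = w ∧ i ∈ R then q.1 a i + q.2 ⟨i, h.2⟩ else q.1 a i)
    (fun _ _ => Finset.mem_coe.2 (Finset.mem_univ _)) ?_
  rintro ⟨E, u⟩ hE ⟨E', u'⟩ hE' h
  simp only [Finset.coe_product, Set.mem_prod, Finset.mem_coe, Finset.mem_filter,
    Finset.mem_univ, true_and, and_true] at hE hE'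
  have happ : ∀ a i, (if h : a = w ∧ i ∈ R then E a i + u ⟨i, h.2⟩ else E a i) =
      (if h : a = w ∧ i ∈ R then E' a i + u' ⟨i, h.2⟩ else E' a i) :=
    fun a i => congrFun (congrFun h a) i
  have hne : ∀ a, a ≠ w → ∀ i, E a i = E' a i := fun a ha i => by simpa [ha] using happ a i
  have hu : u = u' := by
    ext ⟨i, hi⟩
    have := happ w i
    simp only [hi, and_self, dif_pos, hE i hi, hE' i hi, hne v hvw.symm] at this
    exact add_left_cancel this
  subst hu
  refine Prod.ext (funext fun a => funext fun i => ?_) rfl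
  by_cases ha : a = w ∧ i ∈ R
  · have := happ a i
    simp only [ha, and_self, dif_pos] at this
    simpa [ha] using add_right_cancel this
  · simpa [ha] using happ a i

/-- The union bound over the wrong messages. -/
lemma natCard_ambiguous_mul_le {A ι α : Type*} [Fintype A] [DecidableEq A] [Fintype ι]
    [DecidableEq ι] [Fintype α] (f : α → A) (hf : Function.Injective f) (v : α) (R : Finset ι) :
    Nat.card {E : A → ι → ZMod 2 // ∃ w, w ≠ v ∧ ∀ i ∈ R, E (f w) i = E (f v) i} * 2 ^ R.card ≤
      Fintype.card α * Fintype.card (A → ι → ZMod 2) := by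
  classical
  rw [Nat.card_eq_fintype_card, Fintype.card_subtype]
  have hsub : (Finset.univ.filter fun E : A → ι → ZMod 2 =>
      ∃ w, w ≠ v ∧ ∀ i ∈ R, E (f w) i = E (f v) i) ⊆
      (Finset.univ.filter fun w : α => w ≠ v).biUnion fun w =>
        Finset.univ.filter fun E : A → ι → ZMod 2 => ∀ i ∈ R, E (f w) i = E (f v) i := by
    intro E
    simp
  calc _ ≤ (∑ w with w ≠ v, (Finset.univ.filter fun E : A → ι → ZMod 2 =>
        ∀ i ∈ R, E (f w) i = E (f v) i).card) * 2 ^ R.card :=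
        Nat.mul_le_mul_right _ ((Finset.card_le_card hsub).trans Finset.card_biUnion_le)
    _ = ∑ w with w ≠ v, (Finset.univ.filter fun E : A → ι → ZMod 2 =>
        ∀ i ∈ R, E (f w) i = E (f v) i).card * 2 ^ R.card := Finset.sum_mul _ _ _
    _ ≤ ∑ w with w ≠ v, Fintype.card (A → ι → ZMod 2) :=
        Finset.sum_le_sum fun w hw => card_collision_le
          (hf.ne (Finset.mem_filter.1 hw).2) R
    _ ≤ _ := by
        rw [Finset.sum_const, smul_eq_mul]
        exact Nat.mul_le_mul_right _ (Finset.card_le_univ _)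

/-- The fraction of the codebooks that do not determine the message `v` from the positions `R`. -/
lemma natCard_ambiguous_le {A ι α : Type*} [Fintype A] [DecidableEq A] [Fintype ι] [DecidableEq ι]
    [Fintype α] (f : α → A) (hf : Function.Injective f) (v : α) (R : Finset ι) {m h : ℕ}
    (hα : Fintype.card α ≤ 2 ^ m) (hR : m + h ≤ R.card) :
    (Nat.card {E : A → ι → ZMod 2 // ∃ w, w ≠ v ∧ ∀ i ∈ R, E (f w) i = E (f v) i} : ℝ) ≤
      (1 / 2) ^ h * Fintype.card (A → ι → ZMod 2) := by
  have hc := natCard_ambiguous_mul_le f hf v R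
  generalize Nat.card {E : A → ι → ZMod 2 // ∃ w, w ≠ v ∧ ∀ i ∈ R, E (f w) i = E (f v) i} = x
    at hc ⊢
  have hp : 2 ^ (m + h) ≤ 2 ^ R.card := Nat.pow_le_pow_right two_pos hR
  have h1 : x * 2 ^ (m + h) ≤ 2 ^ m * Fintype.card (A → ι → ZMod 2) :=
    (Nat.mul_le_mul_left x hp).trans (hc.trans (Nat.mul_le_mul_right _ hα))
  rw [pow_add, mul_left_comm] at h1
  have h2 := Nat.le_of_mul_le_mul_left h1 (by positivity)
  rw [one_div, inv_pow, inv_mul_eq_div, le_div_iff₀ (by positivity)]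
  exact_mod_cast h2

open Classical in
/-- The delivered bits that carry the message `S` when bit `ℓ` of channel use `s` is assigned to the
message `σ s ℓ` and the channel states are `L`. -/
noncomputable def delivered {𝒮 : Type*} {n B : ℕ} (σ : Fin n → Fin B → 𝒮) (S : 𝒮)
    (L : Fin n → Fin (B + 1)) : Finset (Fin n × Fin B) :=
  Finset.univ.filter fun i => (i.2 : ℕ) + 1 ≤ (L i.1 : ℕ) ∧ σ i.1 i.2 = S

lemma measureReal_eq_sum {Ω : Type*} [Fintype Ω] [MeasurableSpace Ω] [MeasurableSingletonClass Ω]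
    (ν : Measure Ω) [IsFiniteMeasure ν] (A : Set Ω) [DecidablePred (· ∈ A)] :
    ν.real A = ∑ L, if L ∈ A then ν.real {L} else 0 := by
  rw [← Finset.sum_filter, sum_measureReal_singleton]
  simp

/-- Averaging the measures of the sections of a relation. -/
lemma sum_measureReal_le {Ω 𝓔 : Type*} [Fintype Ω] [MeasurableSpace Ω]
    [MeasurableSingletonClass Ω] [Fintype 𝓔] (ν : Measure Ω) [IsProbabilityMeasure ν]
    (bad : 𝓔 → Ω → Prop) (U : Set Ω) {ε : ℝ} (hε : 0 ≤ ε)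
    (h : ∀ L, L ∉ U → (Nat.card {E // bad E L} : ℝ) ≤ ε * Fintype.card 𝓔) :
    ∑ E, ν.real {L | bad E L} ≤ Fintype.card 𝓔 * (ν.real U + ε) := by
  classical
  have hone : ∑ L, ν.real {L} = 1 := by
    rw [sum_measureReal_singleton]; simp
  calc ∑ E, ν.real {L | bad E L}
      = ∑ L, (Nat.card {E // bad E L} : ℝ) * ν.real {L} := by
        simp_rw [measureReal_eq_sum ν {L | bad _ L}]
        rw [Finset.sum_comm]
        refine Finset.sum_congr rfl fun L _ => ?_
        simp only [Set.mem_ofPred_eq]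
        rw [← Finset.sum_filter, Finset.sum_const, nsmul_eq_mul, Nat.card_eq_fintype_card,
          Fintype.card_subtype]
    _ ≤ ∑ L, (Fintype.card 𝓔 * (if L ∈ U then ν.real {L} else 0) +
          Fintype.card 𝓔 * ε * ν.real {L}) := by
        refine Finset.sum_le_sum fun L _ => ?_
        have h0 : 0 ≤ ν.real {L} := measureReal_nonneg
        by_cases hL : L ∈ U
        · have : (Nat.card {E // bad E L} : ℝ) ≤ Fintype.card 𝓔 := by
            rw [Nat.card_eq_fintype_card]
            exact_mod_cast Fintype.card_subtype_le _
          simp only [hL, if_true]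
          have := mul_le_mul_of_nonneg_right this h0
          have : 0 ≤ Fintype.card 𝓔 * ε * ν.real {L} := by positivity
          linarith
        · simp only [hL, if_false, mul_zero, zero_add]
          have := mul_le_mul_of_nonneg_right (h L hL) h0
          linarith
    _ = _ := by
        rw [Finset.sum_add_distrib, ← Finset.mul_sum, ← Finset.mul_sum, ← measureReal_eq_sum, hone]
        ring

/-- Random coding: if the cache of each user together with the messages `Q k` determines the
requested file, then there is a code whose error probability is small as soon as each message is
carried by sufficiently many delivered bits. -/
lemma exists_code {K N B n F m h : ℕ} {μ : ℝ} (C : CachingStrategy K μ)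
    (P : Fin K → PMF (Fin (B + 1))) (d : Fin K → Fin N) {𝒮 α : Type*} [Fintype 𝒮] [Fintype α]
    (hα : Fintype.card α ≤ 2 ^ m) (Q : Fin K → Finset 𝒮) (M : 𝒮 → Library N F → α)
    (hdec : ∀ k W W', cacheContent C k W = cacheContent C k W' →
      (∀ S ∈ Q k, M S W = M S W') → W (d k) = W' (d k))
    (σ : Fin n → Fin B → 𝒮) :
    ∃ c : Code C N B n F, c.errorProb P d ≤
      ∑ k, ∑ S ∈ Q k, ((Measure.pi fun _ : Fin n => (P k).toMeasure).real
        {L | (delivered σ S L).card < m + h} + (1 / 2) ^ h) := by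
  classical
  let enc : (𝒮 × α → Fin n × Fin B → ZMod 2) → Library N F → Fin n → Fin B → ZMod 2 :=
    fun E W s ℓ => E (σ s ℓ, M (σ s ℓ) W) (s, ℓ)
  -- Any library consistent with the outputs and the cache will do: it only has to share the
  -- messages in `Q k` with the true one. The default 0 is never used on actual outputs, because the
  -- true library is consistent.
  let cd : (𝒮 × α → Fin n × Fin B → ZMod 2) → Code C N B n F := fun E =>
    { encode := enc E
      decode := fun k L Y Z => if hW : ∃ W : Library N F,
          (fun s => received (L s) (enc E W s)) = Y ∧ cacheContent C k W = Z
        then hW.choose (d k) else 0 }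
  let bad : Library N F → 𝒮 → (𝒮 × α → Fin n × Fin B → ZMod 2) → (Fin n → Fin (B + 1)) → Prop :=
    fun W S E L => ∃ w, w ≠ M S W ∧ ∀ i ∈ delivered σ S L, E (S, w) i = E (S, M S W) i
  have hgood : ∀ E k W L, (∀ S ∈ Q k, ¬ bad W S E L) → (cd E).estimate k W L = W (d k) := by
    intro E k W L hb
    have hex : ∃ W' : Library N F, (fun s => received (L s) (enc E W' s)) =
        (fun s => received (L s) (enc E W s)) ∧ cacheContent C k W' = cacheContent C k W :=
      ⟨W, rfl, rfl⟩
    have hval : (cd E).estimate k W L = hex.choose (d k) := dif_pos hex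
    rw [hval]
    obtain ⟨h1, h2⟩ := hex.choose_spec
    refine hdec k _ _ h2 fun S hS => ?_
    by_contra hne
    refine hb S hS ⟨_, hne, ?_⟩
    rintro ⟨s, ℓ⟩ hi
    simp only [delivered, Finset.mem_filter, Finset.mem_univ, true_and] at hi
    have := congrFun (congrFun h1 s) ℓ
    simpa [received, hi.1, enc, hi.2] using this
  set b : ℝ := ∑ k, ∑ S ∈ Q k, ((Measure.pi fun _ : Fin n => (P k).toMeasure).real
        {L | (delivered σ S L).card < m + h} + (1 / 2) ^ h) with hb
  have hlib : (0 : ℝ) < Fintype.card (Library N F) := by exact_mod_cast Fintype.card_pos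
  have hsum : ∀ k W, ∑ E, (Measure.pi fun _ : Fin n => (P k).toMeasure).real
      {L | (cd E).estimate k W L ≠ W (d k)} ≤
      Fintype.card (𝒮 × α → Fin n × Fin B → ZMod 2) *
        ∑ S ∈ Q k, ((Measure.pi fun _ : Fin n => (P k).toMeasure).real
        {L | (delivered σ S L).card < m + h} + (1 / 2) ^ h) := by
    intro k W
    calc _ ≤ ∑ E, ∑ S ∈ Q k, (Measure.pi fun _ : Fin n => (P k).toMeasure).real
          {L | bad W S E L} := by
          refine Finset.sum_le_sum fun E _ => ?_
          refine (measureReal_mono (s₂ := ⋃ S ∈ Q k, {L | bad W S E L}) ?_ (measure_ne_top _ _)).trans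
            (measureReal_biUnion_finset_le _ _)
          intro L hL
          by_contra hL'
          simp only [Set.mem_iUnion, Set.mem_ofPred_eq, not_exists] at hL'
          exact hL (hgood E k W L hL')
      _ = ∑ S ∈ Q k, ∑ E, (Measure.pi fun _ : Fin n => (P k).toMeasure).real
          {L | bad W S E L} := Finset.sum_comm
      _ ≤ _ := by
          rw [Finset.mul_sum]
          refine Finset.sum_le_sum fun S _ => sum_measureReal_le _ (bad W S) _ (by positivity) ?_
          intro L hL
          simp only [Set.mem_ofPred_eq, not_lt] at hL
          exact natCard_ambiguous_le (fun w : α => (S, w)) (Prod.mk_right_injective S) (M S W)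
            (delivered σ S L) hα hL
  -- The bound is averaged after summing over users and libraries, so a single codebook meets it for
  -- all of them together.
  have havg : ∑ E, (cd E).errorProb P d ≤ ∑ _E : 𝒮 × α → Fin n × Fin B → ZMod 2, b := by
    simp only [Code.errorProb]
    rw [Finset.sum_comm, Finset.sum_const, Finset.card_univ, nsmul_eq_mul, hb, Finset.mul_sum]
    refine Finset.sum_le_sum fun k _ => ?_
    rw [← Finset.sum_div, div_le_iff₀ hlib, Finset.sum_comm]
    refine (Finset.sum_le_sum fun W _ => hsum k W).trans ?_
    rw [Finset.sum_const, Finset.card_univ, nsmul_eq_mul, mul_comm]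
  obtain ⟨E, -, hE⟩ := Finset.exists_le_of_sum_le Finset.univ_nonempty havg
  exact ⟨cd E, hE⟩

/-! ### Concentration of the number of delivered bits -/

lemma ccdf_nonneg {B : ℕ} (p : PMF (Fin (B + 1))) (ℓ : Fin B) : 0 ≤ ccdf p ℓ := measureReal_nonneg

lemma ccdf_le_one {B : ℕ} (p : PMF (Fin (B + 1))) (ℓ : Fin B) : ccdf p ℓ ≤ 1 := measureReal_le_one

/-- Chebyshev's inequality for a sum of functions of independent channel states. -/
lemma measureReal_sum_lt_le {n B : ℕ} (p : PMF (Fin (B + 1))) (g : Fin n → Fin (B + 1) → ℝ)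
    {b : ℝ} (hg : ∀ s x, g s x ∈ Set.Icc 0 b) {m δ : ℝ} (hδ : 0 < δ)
    (hm : m + δ ≤ ∑ s, ∫ x, g s x ∂p.toMeasure) :
    (Measure.pi fun _ : Fin n => p.toMeasure).real {L | ∑ s, g s (L s) < m} ≤
      n * (b / 2) ^ 2 / δ ^ 2 := by
  set ν := Measure.pi fun _ : Fin n => p.toMeasure with hν
  have hmem : ∀ s, MemLp (g s) 2 p.toMeasure := fun s =>
    memLp_of_bounded (ae_of_all _ (hg s)) (measurable_of_finite _).aestronglyMeasurable 2
  set X : (Fin n → Fin (B + 1)) → ℝ := ∑ s, fun L => g s (L s) with hX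
  have hXmem : MemLp X 2 ν := by
    refine memLp_finsetSum' _ fun s _ => ?_
    exact memLp_of_bounded (ae_of_all _ fun L : Fin n → Fin (B + 1) => hg s (L s))
      (measurable_of_finite _).aestronglyMeasurable 2
  -- A variable with values in `[0, b]` has variance at most `(b / 2) ^ 2`.
  have hvar : ProbabilityTheory.variance X ν ≤ n * (b / 2) ^ 2 := by
    rw [hX, hν, ProbabilityTheory.variance_sum_pi (X := fun s x => g s x) hmem]
    calc _ ≤ ∑ _s : Fin n, (b / 2) ^ 2 := Finset.sum_le_sum fun s _ => by
            simpa using ProbabilityTheory.variance_le_sq_of_bounded (ae_of_all _ (hg s))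
              (measurable_of_finite (g s)).aemeasurable
      _ = _ := by simp
  have hmean : ∫ L, X L ∂ν = ∑ s, ∫ x, g s x ∂p.toMeasure := by
    simp only [hX, Finset.sum_apply]
    rw [integral_finsetSum _ fun s _ => ?_]
    · exact Finset.sum_congr rfl fun s _ =>
        integral_comp_eval (μ := fun _ : Fin n => p.toMeasure) (i := s)
          (measurable_of_finite (g s)).aestronglyMeasurable
    · exact (memLp_of_bounded (ae_of_all _ fun L : Fin n → Fin (B + 1) => hg s (L s))
        (measurable_of_finite _).aestronglyMeasurable 1).integrable le_rfl
  have hcheb := ProbabilityTheory.meas_ge_le_variance_div_sq hXmem hδ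
  have hnn : 0 ≤ ProbabilityTheory.variance X ν / δ ^ 2 :=
    div_nonneg (ProbabilityTheory.variance_nonneg _ _) (sq_nonneg _)
  calc ν.real {L | ∑ s, g s (L s) < m} ≤ ν.real {L | δ ≤ |X L - ∫ L, X L ∂ν|} := by
        refine measureReal_mono (fun L hL => ?_) (measure_ne_top _ _)
        simp only [Set.mem_ofPred_eq] at hL ⊢
        have hXL : X L = ∑ s, g s (L s) := by simp [hX]
        rw [hmean, hXL, abs_sub_comm]
        exact le_trans (by linarith) (le_abs_self _)
    _ ≤ ProbabilityTheory.variance X ν / δ ^ 2 := by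
        have := ENNReal.toReal_mono ENNReal.ofReal_ne_top hcheb
        rwa [ENNReal.toReal_ofReal hnn] at this
    _ ≤ _ := by gcongr

/-- With high probability each message is carried by about as many delivered bits as on average. -/
lemma measureReal_delivered_lt_le {𝒮 : Type*} {n B : ℕ} (p : PMF (Fin (B + 1)))
    (σ : Fin n → Fin B → 𝒮) (S : 𝒮) (a : Fin B → ℕ)
    (ha : ∀ ℓ, a ℓ ≤ Nat.card {s // σ s ℓ = S}) {m : ℕ} {δ : ℝ} (hδ : 0 < δ)
    (hm : m + δ ≤ ∑ ℓ, ccdf p ℓ * a ℓ) :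
    (Measure.pi fun _ : Fin n => p.toMeasure).real {L | (delivered σ S L).card < m} ≤
      n * ((B : ℝ) / 2) ^ 2 / δ ^ 2 := by
  classical
  -- The levels of one channel use are dependent, so they are grouped into one summand with values
  -- in `[0, B]`; only different uses are independent.
  set g : Fin n → Fin (B + 1) → ℝ := fun s x =>
    ∑ ℓ : Fin B, if (ℓ : ℕ) + 1 ≤ (x : ℕ) ∧ σ s ℓ = S then 1 else 0 with hgdef
  have hg : ∀ s x, g s x ∈ Set.Icc (0 : ℝ) B := by
    intro s x
    refine ⟨Finset.sum_nonneg fun ℓ _ => by split_ifs <;> norm_num, ?_⟩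
    calc g s x ≤ ∑ _ℓ : Fin B, (1 : ℝ) :=
          Finset.sum_le_sum fun ℓ _ => by split_ifs <;> norm_num
      _ = B := by simp
  have hcard : ∀ L, ((delivered σ S L).card : ℝ) = ∑ s, g s (L s) := by
    intro L
    rw [delivered, Finset.card_filter, ← Finset.univ_product_univ, Finset.sum_product]
    push_cast
    rfl
  have hint : ∀ s, ∫ x, g s x ∂p.toMeasure = ∑ ℓ, if σ s ℓ = S then ccdf p ℓ else 0 := by
    intro s
    rw [hgdef]
    simp only
    rw [integral_finsetSum _ fun ℓ _ => Integrable.of_finite]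
    refine Finset.sum_congr rfl fun ℓ _ => ?_
    by_cases h : σ s ℓ = S
    · have : (fun x : Fin (B + 1) => if (ℓ : ℕ) + 1 ≤ (x : ℕ) ∧ σ s ℓ = S then (1 : ℝ) else 0) =
          Set.indicator {x : Fin (B + 1) | (ℓ : ℕ) + 1 ≤ (x : ℕ)} 1 := by
        ext x
        simp [Set.indicator_apply, h]
      rw [this, integral_indicator_one (Set.toFinite _).measurableSet]
      simp [h, ccdf]
    · simp [h]
  have hmean : ∑ ℓ, ccdf p ℓ * a ℓ ≤ ∑ s, ∫ x, g s x ∂p.toMeasure := by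
    simp_rw [hint]
    rw [Finset.sum_comm]
    refine Finset.sum_le_sum fun ℓ _ => ?_
    rw [← Finset.sum_filter, Finset.sum_const, nsmul_eq_mul, mul_comm]
    refine mul_le_mul_of_nonneg_right ?_ (ccdf_nonneg p ℓ)
    have := ha ℓ
    rw [Nat.card_eq_fintype_card, Fintype.card_subtype] at this
    exact_mod_cast this
  have h := measureReal_sum_lt_le p g hg hδ (hm.trans hmean)
  have hset : {L | (delivered σ S L).card < m} = {L | ∑ s, g s (L s) < m} := by
    ext L
    simp only [Set.mem_ofPred_eq, ← hcard, Nat.cast_lt]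
  rwa [hset]

/-- Slots can be assigned so that each `S` gets at least `a S` of them. -/
lemma exists_assignment {𝒮 : Type*} [Fintype 𝒮] [Nonempty 𝒮] {n : ℕ} (a : 𝒮 → ℕ)
    (ha : ∑ S, a S ≤ n) : ∃ σ : Fin n → 𝒮, ∀ S, a S ≤ Nat.card {s // σ s = S} := by
  classical
  have hcard : Fintype.card (Σ S, Fin (a S)) ≤ Fintype.card (Fin n) := by simpa using ha
  obtain ⟨e⟩ := Function.Embedding.nonempty_of_card_le hcard
  -- Surplus slots go to an arbitrary index, which is harmless for lower bounds.
  refine ⟨Function.extend e Sigma.fst fun _ => Classical.arbitrary 𝒮, fun S => ?_⟩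
  have := Nat.card_le_card_of_injective
    (fun j : Fin (a S) => (⟨e ⟨S, j⟩, e.injective.extend_apply _ _ _⟩ :
      {s // Function.extend e Sigma.fst (fun _ => Classical.arbitrary 𝒮) s = S}))
    (fun j j' h => by simpa using h)
  simpa using this

/-! ### The linear program attains its maximum -/

section LinearProgram

variable {K B t : ℕ} {P : Fin K → PMF (Fin (B + 1))}

lemma exists_card_eq_of_lt (htK : t < K) (k : Fin K) :
    ∃ S : {S : Finset (Fin K) // S.card = t + 1}, k ∈ S.1 := by
  obtain ⟨S, hS, hcard⟩ := Finset.exists_superset_card_eq (s := {k}) (n := t + 1) (by simp)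
    (by simpa using htK)
  exact ⟨⟨S, hcard⟩, Finset.singleton_subset_iff.1 hS⟩

lemma LPFeasible.allocation_le_one {f : ℝ}
    {y : Fin B → {S : Finset (Fin K) // S.card = t + 1} → ℝ} (h : LPFeasible P t f y) (ℓ S) :
    y ℓ S ≤ 1 :=
  (Finset.single_le_sum (fun S _ => h.nonneg ℓ S) (Finset.mem_univ S)).trans (h.level ℓ)

/-- A single decodability constraint suffices, since each of its `B` terms is at most 1. This bounds
the feasible set for the compactness argument. -/
lemma LPFeasible.rate_le (htK : t < K) {f : ℝ}
    {y : Fin B → {S : Finset (Fin K) // S.card = t + 1} → ℝ} (h : LPFeasible P t f y) :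
    f ≤ B * K.choose t := by
  have hc : (0 : ℝ) < K.choose t := by exact_mod_cast Nat.choose_pos htK.le
  obtain ⟨S, hS⟩ := exists_card_eq_of_lt htK ⟨t, htK⟩
  rw [← div_le_iff₀ hc]
  calc _ ≤ _ := h.decodable S _ hS
    _ ≤ ∑ _ℓ : Fin B, (1 : ℝ) := Finset.sum_le_sum fun ℓ _ =>
        mul_le_one₀ (ccdf_le_one _ _) (h.nonneg ℓ S) (h.allocation_le_one ℓ S)
    _ = B := by simp

lemma lpFeasible_zero : LPFeasible P t 0 0 where
  rate_nonneg := le_rfl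
  nonneg _ _ := le_rfl
  level _ := by simp
  decodable _ _ _ := by simp

lemma isCompact_lpRates (htK : t < K) : IsCompact (lpRates P t) := by
  set Y := Fin B → {S : Finset (Fin K) // S.card = t + 1} → ℝ
  set A : Set (ℝ × Y) := {q | LPFeasible P t q.1 q.2} with hA
  have himage : lpRates P t = Prod.fst '' A := by
    ext f
    constructor
    · rintro ⟨y, hy⟩
      exact ⟨(f, y), hy, rfl⟩
    · rintro ⟨⟨_, y⟩, hy, rfl⟩
      exact ⟨y, hy⟩
  have hclosed : IsClosed A := by
    have : A = {q | 0 ≤ q.1} ∩ (⋂ ℓ, ⋂ S, {q | 0 ≤ q.2 ℓ S}) ∩ (⋂ ℓ, {q | ∑ S, q.2 ℓ S ≤ 1}) ∩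
        ⋂ S : {S : Finset (Fin K) // S.card = t + 1}, ⋂ k ∈ S.1,
          {q | q.1 / (K.choose t : ℝ) ≤ ∑ ℓ, ccdf (P k) ℓ * q.2 ℓ S} := by
      ext q
      simp only [hA, Set.mem_ofPred_eq, Set.mem_inter_iff, Set.mem_iInter]
      exact ⟨fun h => ⟨⟨⟨h.1, h.2⟩, h.3⟩, h.4⟩, fun h => ⟨h.1.1.1, h.1.1.2, h.1.2, h.2⟩⟩
    rw [this]
    refine ((IsClosed.inter ?_ ?_).inter ?_).inter ?_
    · exact isClosed_le (by fun_prop) (by fun_prop)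
    · exact isClosed_iInter fun ℓ => isClosed_iInter fun S =>
        isClosed_le (by fun_prop) (by fun_prop)
    · exact isClosed_iInter fun ℓ => isClosed_le (by fun_prop) (by fun_prop)
    · exact isClosed_iInter fun S => isClosed_iInter fun k => isClosed_iInter fun _ =>
        isClosed_le (by fun_prop) (by fun_prop)
  have hsub : A ⊆ Set.Icc (0 : ℝ × Y) (B * K.choose t, fun _ _ => 1) := fun q hq =>
    ⟨⟨hq.rate_nonneg, hq.nonneg⟩, ⟨hq.rate_le htK, hq.allocation_le_one⟩⟩
  rw [himage]
  exact (isCompact_Icc.of_isClosed_subset hclosed hsub).image continuous_fst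

lemma isGreatest_fLP (htK : t < K) : IsGreatest (lpRates P t) (fLP P t) :=
  (isCompact_lpRates htK).isGreatest_sSup ⟨0, 0, lpFeasible_zero⟩

end LinearProgram

/-! ### Codes below and at the optimal rate -/

variable {K N B t : ℕ} {μ : ℝ} {P : Fin K → PMF (Fin (B + 1))} {C : CachingStrategy K μ}

lemma Code.errorProb_nonneg {n F : ℕ} (c : Code C N B n F) (d : Fin K → Fin N) :
    0 ≤ c.errorProb P d :=
  Finset.sum_nonneg fun _ _ =>
    div_nonneg (Finset.sum_nonneg fun _ _ => measureReal_nonneg) (Nat.cast_nonneg _)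

/-- A code for files of `F` bits at block length `n`, built from an allocation `y`. -/
lemma exists_code_of_allocation (hC : C.IsCentralized t) (htK : t < K) (d : Fin K → Fin N)
    {y : Fin B → {S : Finset (Fin K) // S.card = t + 1} → ℝ} {f' : ℝ}
    (hy : LPFeasible P t f' y) (n F h : ℕ) {δ : ℝ} (hδ : 0 < δ)
    (hm : (F : ℝ) / K.choose t + (K + 1) * C.endpoints.card + h + δ ≤ n * (f' / K.choose t) - B) :
    ∃ c : Code C N B n F, c.errorProb P d ≤
      K * (Fintype.card {S : Finset (Fin K) // S.card = t + 1} *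
        (n * ((B : ℝ) / 2) ^ 2 / δ ^ 2 + (1 / 2) ^ h)) := by
  classical
  set e := C.endpoints.card with he
  set g := ⌊(F : ℝ) / K.choose t + e⌋₊ with hg
  have hg0 : (0 : ℝ) ≤ (F : ℝ) / K.choose t + e := by positivity
  obtain ⟨S₀, -⟩ := exists_card_eq_of_lt htK ⟨t, htK⟩
  have : Nonempty {S : Finset (Fin K) // S.card = t + 1} := ⟨S₀⟩
  obtain ⟨M, hM⟩ := exists_codedMessages (g := g) (t := t) C d fun T hT => by
    rw [Nat.card_eq_fintype_card, Fintype.card_subtype]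
    exact Nat.le_floor (hC.card_cachers_eq_le F hT)
  have hassign : ∀ ℓ, ∃ σ : Fin n → {S : Finset (Fin K) // S.card = t + 1},
      ∀ S, ⌊n * y ℓ S⌋₊ ≤ Nat.card {s // σ s = S} := by
    intro ℓ
    refine exists_assignment (fun S => ⌊n * y ℓ S⌋₊) ?_
    have h1 : ∑ S, ((⌊n * y ℓ S⌋₊ : ℕ) : ℝ) ≤ ∑ S, n * y ℓ S :=
      Finset.sum_le_sum fun S _ => Nat.floor_le (mul_nonneg (Nat.cast_nonneg _) (hy.nonneg ℓ S))
    rw [← Finset.mul_sum] at h1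
    have h2 := mul_le_mul_of_nonneg_left (hy.level ℓ) (Nat.cast_nonneg (α := ℝ) n)
    have h3 : ((∑ S, ⌊n * y ℓ S⌋₊ : ℕ) : ℝ) ≤ (n : ℕ) := by push_cast; linarith
    exact_mod_cast h3
  choose σ hσ using hassign
  -- The message length is `g + K * e`: a piece of at most `F / K.choose t + e` bits, and at most
  -- `e` exceptional bits for each user. This gives the term `(K + 1) * e` in the hypothesis.
  have hcard : Fintype.card ((Fin g → ZMod 2) ×
      (Fin K × {i : Fin F // (C.cachers i).card ≠ t} → ZMod 2)) ≤ 2 ^ (g + K * e) := by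
    have hex : Fintype.card {i : Fin F // (C.cachers i).card ≠ t} ≤ e := by
      rw [Fintype.card_subtype]
      exact hC.card_cachers_ne_le htK F
    rw [Fintype.card_prod, Fintype.card_fun, Fintype.card_fun, ZMod.card, Fintype.card_fin,
      Fintype.card_prod, Fintype.card_fin, ← pow_add]
    exact Nat.pow_le_pow_right two_pos (Nat.add_le_add_left (Nat.mul_le_mul_left K hex) g)
  obtain ⟨c, hc⟩ := exists_code (h := h) C P d hcard
    (fun k => Finset.univ.filter fun S : {S : Finset (Fin K) // S.card = t + 1} => k ∈ S.1) M
    (fun k W W' hW hS => hM k W W' hW (fun S hkS => hS S (by simpa using hkS))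
      (exists_card_eq_of_lt htK k)) (fun s ℓ => σ ℓ s)
  have hnonneg : 0 ≤ n * ((B : ℝ) / 2) ^ 2 / δ ^ 2 + (1 / 2) ^ h := by positivity
  refine ⟨c, hc.trans ?_⟩
  calc _ ≤ ∑ _k : Fin K, (Fintype.card {S : Finset (Fin K) // S.card = t + 1} *
        (n * ((B : ℝ) / 2) ^ 2 / δ ^ 2 + (1 / 2) ^ h)) := Finset.sum_le_sum fun k _ => ?_
    _ = _ := by simp
  calc _ ≤ ∑ S ∈ Finset.univ.filter fun S : {S : Finset (Fin K) // S.card = t + 1} => k ∈ S.1,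
        (n * ((B : ℝ) / 2) ^ 2 / δ ^ 2 + (1 / 2) ^ h) := Finset.sum_le_sum fun S hS => ?_
    _ ≤ _ := by
      rw [Finset.sum_const, nsmul_eq_mul]
      exact mul_le_mul_of_nonneg_right (Nat.cast_le.2 (Finset.card_le_univ _)) hnonneg
  refine add_le_add_left (measureReal_delivered_lt_le (P k) _ S (fun ℓ => ⌊n * y ℓ S⌋₊)
    (fun ℓ => hσ ℓ S) hδ ?_) _
  have hkS : k ∈ S.1 := by simpa using hS
  -- Rounding `n * y ℓ S` down costs at most one slot per level, hence `B`.
  have h1 : n * (f' / K.choose t) - B ≤ ∑ ℓ, ccdf (P k) ℓ * (⌊n * y ℓ S⌋₊ : ℝ) := by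
    calc n * (f' / K.choose t) - B ≤ n * (∑ ℓ, ccdf (P k) ℓ * y ℓ S) - ∑ _ℓ : Fin B, (1 : ℝ) := by
          have := mul_le_mul_of_nonneg_left (hy.decodable S k hkS) (Nat.cast_nonneg (α := ℝ) n)
          simp only [Finset.sum_const, Finset.card_univ, Fintype.card_fin, nsmul_eq_mul, mul_one]
          linarith
      _ ≤ _ := by
          rw [Finset.mul_sum, ← Finset.sum_sub_distrib]
          refine Finset.sum_le_sum fun ℓ _ => ?_
          have h2 := Nat.sub_one_lt_floor ((n : ℝ) * y ℓ S)
          have h3 := ccdf_nonneg (P k) ℓ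
          have h4 := ccdf_le_one (P k) ℓ
          nlinarith
  have hgle : (g : ℝ) ≤ F / K.choose t + e := Nat.floor_le hg0
  push_cast
  linarith

/-- The slack is `n κ`. One quarter serves as the Chebyshev deviation, one as the excess `h`, and
the remaining half covers the constant `D` once `n ≥ 2 D / κ`. The error is then `O(1 / n)` plus an
exponentially small term. -/
lemma reliablyServed_of_lt (hC : C.IsCentralized t) (htK : t < K) (d : Fin K → Fin N)
    {f f' : ℝ} (hf : 0 ≤ f) (hff' : f < f') (hf' : f' ∈ lpRates P t) :
    ReliablyServed C P d fun n => ⌊(n : ℝ) * f⌋₊ := by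
  classical
  obtain ⟨y, hy⟩ := hf'
  have hch : (0 : ℝ) < K.choose t := by exact_mod_cast Nat.choose_pos htK.le
  set κ := (f' - f) / K.choose t with hκdef
  have hκ : 0 < κ := div_pos (sub_pos.2 hff') hch
  set D : ℝ := (K + 1) * C.endpoints.card + B
  set b : ℕ → ℝ := fun n => K * (Fintype.card {S : Finset (Fin K) // S.card = t + 1} *
      (n * ((B : ℝ) / 2) ^ 2 / (n * κ / 4) ^ 2 + (1 / 2) ^ ⌊κ / 4 * (n : ℝ)⌋₊)) with hb
  have hex : ∀ᶠ n : ℕ in atTop, ∃ c : Code C N B n ⌊(n : ℝ) * f⌋₊, c.errorProb P d ≤ b n := by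
    have hlarge : ∀ᶠ n : ℕ in atTop, 2 * D / κ ≤ n :=
      tendsto_natCast_atTop_atTop.eventually_ge_atTop _
    filter_upwards [hlarge, eventually_gt_atTop 0] with n hn hn0
    have hn0' : (0 : ℝ) < n := by exact_mod_cast hn0
    refine exists_code_of_allocation hC htK d hy n _ _ (by positivity) ?_
    rw [div_le_iff₀ hκ] at hn
    have h1 : ((⌊(n : ℝ) * f⌋₊ : ℕ) : ℝ) / K.choose t ≤ n * f / K.choose t := by
      gcongr
      exact Nat.floor_le (by positivity)
    have h2 : ((⌊κ / 4 * (n : ℝ)⌋₊ : ℕ) : ℝ) ≤ κ / 4 * n := Nat.floor_le (by positivity)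
    have h3 : (n : ℝ) * (f' / K.choose t) = n * f / K.choose t + n * κ := by
      rw [hκdef]; ring
    simp only [D] at hn
    linarith
  have hlim : Tendsto b atTop (𝓝 0) := by
    have h1 : Tendsto (fun n : ℕ => (n : ℝ) * ((B : ℝ) / 2) ^ 2 / (n * κ / 4) ^ 2) atTop (𝓝 0) := by
      refine (tendsto_const_div_atTop_nhds_zero_nat (((B : ℝ) / 2) ^ 2 / (κ / 4) ^ 2)).congr' ?_
      filter_upwards [eventually_gt_atTop 0] with n hn0
      have hn0' : (n : ℝ) ≠ 0 := by exact_mod_cast hn0.ne'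
      field_simp
    have h2 : Tendsto (fun n : ℕ => ((1 : ℝ) / 2) ^ ⌊κ / 4 * (n : ℝ)⌋₊) atTop (𝓝 0) :=
      (tendsto_pow_atTop_nhds_zero_of_lt_one (by norm_num) (by norm_num)).comp
        (tendsto_nat_floor_atTop.comp
          (tendsto_natCast_atTop_atTop.const_mul_atTop (by positivity)))
    simpa [hb] using ((h1.add h2).const_mul
      (Fintype.card {S : Finset (Fin K) // S.card = t + 1} : ℝ)).const_mul (K : ℝ)
  -- Block lengths too small for the bound get the zero code.
  have hcode : ∀ n : ℕ, ∃ c : Code C N B n ⌊(n : ℝ) * f⌋₊,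
      (∃ c' : Code C N B n ⌊(n : ℝ) * f⌋₊, c'.errorProb P d ≤ b n) → c.errorProb P d ≤ b n := by
    intro n
    by_cases h : ∃ c' : Code C N B n ⌊(n : ℝ) * f⌋₊, c'.errorProb P d ≤ b n
    · exact ⟨h.choose, fun _ => h.choose_spec⟩
    · exact ⟨⟨0, 0⟩, fun h' => absurd h' h⟩
  choose c hc using hcode
  refine ⟨c, squeeze_zero' (Eventually.of_forall fun n => (c n).errorProb_nonneg d) ?_ hlim⟩
  filter_upwards [hex] with n hn using hc n hn

lemma reliablyServed_zero (C : CachingStrategy K μ) (P : Fin K → PMF (Fin (B + 1)))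
    (d : Fin K → Fin N) : ReliablyServed C P d fun _ => 0 := by
  refine ⟨fun _ => ⟨0, 0⟩, tendsto_const_nhds.congr fun n => Eq.symm ?_⟩
  refine Finset.sum_eq_zero fun k _ => ?_
  rw [Finset.sum_eq_zero fun W _ => ?_, zero_div]
  have : {L | (⟨0, 0⟩ : Code C N B n 0).estimate k W L ≠ W (d k)} = ∅ := by
    ext L
    simpa using Subsingleton.elim _ _
  rw [this, measureReal_empty]

/-- If each of countably many properties holds eventually, then they hold along a sequence of
indices that grows sufficiently slowly. -/
lemma exists_tendsto_atTop_eventually {p : ℕ → ℕ → Prop} (h : ∀ j, ∀ᶠ n in atTop, p j n) :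
    ∃ g : ℕ → ℕ, Tendsto g atTop atTop ∧ ∀ᶠ n in atTop, p (g n) n := by
  classical
  choose m hm using fun j => eventually_atTop.1 (h j)
  -- Take the largest index up to `n` whose threshold has been passed; from `m 0` on, index 0
  -- qualifies, so there is one.
  refine ⟨fun n => Nat.findGreatest (fun j => m j ≤ n) n, tendsto_atTop.2 fun b => ?_, ?_⟩
  · filter_upwards [eventually_ge_atTop b, eventually_ge_atTop (m b)] with n h1 h2
    exact Nat.le_findGreatest h1 h2
  · filter_upwards [eventually_ge_atTop (m 0)] with n hn
    exact hm _ n (Nat.findGreatest_spec (P := fun j => m j ≤ n) (Nat.zero_le n) hn)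

/-- A diagonal argument: use the code for rate `r j < f` with an index `j = g n` that grows slowly
enough for the error to stay below `1 / (j + 1)`. Rate 0 has no smaller nonnegative rate and is
served by empty files. -/
lemma isAchievable_of_forall_lt (C : CachingStrategy K μ) (P : Fin K → PMF (Fin (B + 1)))
    (d : Fin K → Fin N) {f : ℝ} (hf : 0 ≤ f)
    (h : ∀ f' : ℝ, 0 ≤ f' → f' < f → ReliablyServed C P d fun n => ⌊(n : ℝ) * f'⌋₊) :
    IsAchievable C P d f := by
  rcases hf.eq_or_lt with rfl | hpos
  · exact ⟨fun _ => 0, by simp, reliablyServed_zero C P d⟩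
  set r : ℕ → ℝ := fun j => f - f / (j + 2) with hr
  have hr0 : ∀ j, 0 ≤ r j := fun j => by
    have : f / (j + 2) ≤ f := div_le_self hf (by linarith [Nat.cast_nonneg (α := ℝ) j])
    simp only [hr]; linarith
  have hrf : ∀ j, r j < f := fun j => by
    have : 0 < f / (j + 2) := by positivity
    simp only [hr]; linarith
  have hrlim : Tendsto r atTop (𝓝 f) := by
    have h1 : Tendsto (fun j : ℕ => f / ((j : ℝ) + 2)) atTop (𝓝 0) :=
      tendsto_const_nhds.div_atTop
        (tendsto_atTop_add_const_right _ _ tendsto_natCast_atTop_atTop)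
    simpa [hr] using tendsto_const_nhds.sub h1
  choose c hc using fun j => h (r j) (hr0 j) (hrf j)
  obtain ⟨g, hg, hgp⟩ := exists_tendsto_atTop_eventually
    (p := fun j n => (c j n).errorProb P d < 1 / ((j : ℝ) + 1))
    fun j => (hc j).eventually_lt_const (by positivity)
  refine ⟨fun n => ⌊(n : ℝ) * r (g n)⌋₊, ?_, fun n => c (g n) n, ?_⟩
  · have hlim := hrlim.comp hg
    have hlow : Tendsto (fun n : ℕ => r (g n) - 1 / (n : ℝ)) atTop (𝓝 f) := by
      simpa using hlim.sub (tendsto_const_div_atTop_nhds_zero_nat (1 : ℝ))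
    refine tendsto_of_tendsto_of_tendsto_of_le_of_le' hlow hlim ?_ ?_
    · filter_upwards [eventually_gt_atTop 0] with n hn
      have hn' : (0 : ℝ) < n := by exact_mod_cast hn
      rw [le_div_iff₀ hn', sub_mul, one_div_mul_cancel hn'.ne', mul_comm]
      exact (Nat.sub_one_lt_floor _).le
    · filter_upwards [eventually_gt_atTop 0] with n hn
      have hn' : (0 : ℝ) < n := by exact_mod_cast hn
      rw [div_le_iff₀ hn', mul_comm]
      simpa [mul_comm] using Nat.floor_le (mul_nonneg hn'.le (hr0 (g n)))
  · refine squeeze_zero' (Eventually.of_forall fun n => (c (g n) n).errorProb_nonneg d)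
      (hgp.mono fun n hn => hn.le) ?_
    exact tendsto_one_div_add_atTop_nhds_zero_nat.comp hg

end CodedCaching

theorem proposition2 {K N B t : ℕ} {μ : ℝ}
    (ht : (K : ℝ) * μ = t) (htK : t < K)
    (P : Fin K → PMF (Fin (B + 1)))
    (C : CodedCaching.CachingStrategy K μ) (hC : C.IsCentralized t)
    (d : Fin K → Fin N) (hd : Function.Injective d) :
    IsGreatest (CodedCaching.lpRates P t) (CodedCaching.fLP P t) ∧
    CodedCaching.IsAchievable C P d (CodedCaching.fLP P t) ∧
    ∀ f : ℝ, 0 ≤ f → f < CodedCaching.fLP P t →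
      CodedCaching.ReliablyServed C P d (fun n => ⌊(n : ℝ) * f⌋₊) := by
  have hmax := CodedCaching.isGreatest_fLP (P := P) htK
  have hlt : ∀ f : ℝ, 0 ≤ f → f < CodedCaching.fLP P t →
      CodedCaching.ReliablyServed C P d (fun n => ⌊(n : ℝ) * f⌋₊) := fun f hf hlt =>
    CodedCaching.reliablyServed_of_lt hC htK d hf hlt hmax.1
  have hnonneg : 0 ≤ CodedCaching.fLP P t := by
    obtain ⟨y, hy⟩ := hmax.1
    exact hy.rate_nonneg
  exact ⟨hmax, CodedCaching.isAchievable_of_forall_lt C P d hnonneg hlt, hlt⟩
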